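/- Consider the following dynamic matching market. Agents of type $H$ and $E$ arrive according to independent Poisson processes of rates $\lambda_H>0$ and $\lambda_E\ge 0$; initially the market holds only $d\ge 0$ altruistic agents, who own an item to give and want nothing ($d=0$: no chains). The compatibility graph has the agents as nodes and an edge $i\to j$ when the waiting agent $j$ finds the item of $i$ compatible. When an agent arrives, potential edges between her and the agents present are realized independently, an edge pointing to an agent of type $T$ having probability $p_T$. Exchanges take place along vertex-disjoint directed cycles of waiting agents and vertex-disjoint directed paths (chain-segments) that start at an altruistic or bridge agent. An agent stops waiting when she receives an item; the last agent of a chain-segment becomes a bridge agent, and a bridge or altruistic agent who gives her item disappears. An *anonymous Markovian* policy $\mathcal P$ chooses at each arrival epoch, possibly at random, a feasible set of disjoint exchanges as a function of the current compatibility graph only (newcomer included), and it commutes with every type-preserving renaming of the agents. It is *stable* if the resulting continuous-time Markov chain of compatibility graphs up to isomorphism has a stationary distribution to which it converges in law from the initial market. Let $w_T^{\mathcal P}\in[0,\infty]$ be the expected time that an agent of type $T$ arriving in steady state waits until she receives an item, with $w_T^{\mathcal P}:=0$ if $\lambda_T=0$. **Proposition.** Let $d\in\mathbb N$, $p_E\in[0,1]$,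 $\lambda_H>0$, $\lambda_E\ge0$, and let $\bar p=1$ if $d=0$, while $\bar p<1$ is arbitrary if $d\ge1$. There is a constant $c>0$, depending only on $d,p_E,\lambda_H,\lambda_E,\bar p$, such that for every $p_H\in(0,\bar p]$ and every stable anonymous Markovian policy $\mathcal P$, $$w_H^{\mathcal P}+w_E^{\mathcal P}\ \ge\ \frac{c}{p_H}.$$ -/

import Mathlib

open MeasureTheory ProbabilityTheory Filter Topology
open scoped ENNReal NNReal unitInterval

namespace DynamicMatching

/-- The two types of agents: hard-to-match and easy-to-match. -/
inductive AgentType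
  | H
  | E
  deriving DecidableEq

/-- Primitives of the market: Poisson arrival rates and compatibility probabilities. -/
structure Params where
  lamH : ℝ≥0
  lamE : ℝ≥0
  pH : I
  pE : I

/-- Arrival rate of agents of type `T`. -/
def Params.rate (θ : Params) : AgentType → ℝ≥0
  | .H => θ.lamH
  | .E => θ.lamE

/-- Total arrival rate. -/
def Params.totalRate (θ : Params) : ℝ≥0 := θ.lamH + θ.lamE

/-- A compatibility graph whose agents carry names in `ℕ`.  The nodes are the waiting agents of
type `H`, the waiting agents of type `E`, and the altruistic/bridge agents, who own an item to give
and do not wait for one.  An edge `(i, j)` says that `j` waits and finds the item of `i`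
compatible. -/
@[ext]
structure Market where
  hard : Finset ℕ
  easy : Finset ℕ
  bridges : Finset ℕ
  edges : Finset (ℕ × ℕ)
  disjoint_hard_easy : Disjoint hard easy
  disjoint_hard_bridges : Disjoint hard bridges
  disjoint_easy_bridges : Disjoint easy bridges
  source_mem : ∀ e ∈ edges, e.1 ∈ (hard ∪ easy) ∪ bridges
  target_mem : ∀ e ∈ edges, e.2 ∈ hard ∪ easy
  loopless : ∀ e ∈ edges, e.1 ≠ e.2

namespace Market

/-- The agents who are waiting for an item. -/
def waiting (m : Market) : Finset ℕ := m.hard ∪ m.easy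

/-- All nodes of the compatibility graph. -/
def nodes (m : Market) : Finset ℕ := m.waiting ∪ m.bridges

/-- The market at time zero: `d` altruistic agents and nobody waiting. -/
def initial (d : ℕ) : Market where
  hard := ∅
  easy := ∅
  bridges := Finset.range d
  edges := ∅
  disjoint_hard_easy := by simp
  disjoint_hard_bridges := by simp
  disjoint_easy_bridges := by simp
  source_mem := by simp
  target_mem := by simp
  loopless := by simp

/-- Renaming the agents. -/
def relabel (g : Equiv.Perm ℕ) (m : Market) : Market where
  hard := m.hard.map g.toEmbedding
  easy := m.easy.map g.toEmbedding
  bridges := m.bridges.map g.toEmbedding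
  edges := m.edges.map (g.prodCongr g).toEmbedding
  disjoint_hard_easy := (Finset.disjoint_map _).2 m.disjoint_hard_easy
  disjoint_hard_bridges := (Finset.disjoint_map _).2 m.disjoint_hard_bridges
  disjoint_easy_bridges := (Finset.disjoint_map _).2 m.disjoint_easy_bridges
  source_mem := by
    intro e he
    obtain ⟨f, hf, rfl⟩ := Finset.mem_map.1 he
    have h := m.source_mem f hf
    simpa using h
  target_mem := by
    intro e he
    obtain ⟨f, hf, rfl⟩ := Finset.mem_map.1 he
    have h := m.target_mem f hf
    simpa using h
  loopless := by
    intro e he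
    obtain ⟨f, hf, rfl⟩ := Finset.mem_map.1 he
    have h := m.loopless f hf
    simpa using h

/-- Two markets are isomorphic when they differ only in the names of the agents; types, the
bridge/waiting status and the compatibilities agree. -/
def isoSetoid : Setoid Market where
  r m m' := ∃ g : Equiv.Perm ℕ, m' = m.relabel g
  iseqv :=
    { refl := fun m => ⟨Equiv.refl ℕ, by ext <;> simp [relabel]⟩
      symm := by
        rintro m _ ⟨g, rfl⟩
        refine ⟨g.symm, ?_⟩
        ext <;> simp [relabel, Prod.map]
      trans := by
        rintro m _ _ ⟨g, rfl⟩ ⟨g', rfl⟩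
        refine ⟨g.trans g', ?_⟩
        ext <;> simp only [relabel, Finset.mem_map_equiv] <;> rfl }

/-- Compatibility graphs up to isomorphism. -/
def IsoClass : Type := Quotient isoSetoid

/-- The isomorphism class of a market. -/
def toClass (m : Market) : IsoClass := Quotient.mk isoSetoid m

/-- A name that is not in use; the next arriving agent receives it. -/
def fresh (m : Market) : ℕ := m.nodes.sup id + 1

/-- The fresh name is indeed unused. -/
theorem fresh_notMem (m : Market) : m.fresh ∉ m.nodes := fun h => by
  have : m.fresh ≤ m.nodes.sup id := Finset.le_sup (f := id) h
  unfold fresh at this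
  omega

/-- The ordered pairs on which an arriving agent gives rise to new potential edges: from every node
to the newcomer, and from the newcomer to every waiting agent. -/
def newPairs (m : Market) : Finset (ℕ × ℕ) :=
  (m.nodes ×ˢ {m.fresh}) ∪ ({m.fresh} ×ˢ m.waiting)

/-- The market after the arrival of an agent of type `T`, when `N` is the set of those new pairs
that turn out to be compatible. -/
def arrive (m : Market) (T : AgentType) (N : Finset (ℕ × ℕ)) : Market where
  hard := if T = .H then insert m.fresh m.hard else m.hard
  easy := if T = .E then insert m.fresh m.easy else m.easy
  bridges := m.bridges
  edges := m.edges ∪ (N ∩ m.newPairs)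
  disjoint_hard_easy := by
    have h := m.fresh_notMem
    have h' := m.disjoint_hard_easy
    simp only [nodes, waiting, Finset.mem_union, not_or] at h
    cases T <;> simp [h, h']
  disjoint_hard_bridges := by
    have h := m.fresh_notMem
    have h' := m.disjoint_hard_bridges
    simp only [nodes, waiting, Finset.mem_union, not_or] at h
    cases T <;> simp [h, h']
  disjoint_easy_bridges := by
    have h := m.fresh_notMem
    have h' := m.disjoint_easy_bridges
    simp only [nodes, waiting, Finset.mem_union, not_or] at h
    cases T <;> simp [h, h']
  source_mem := by
    intro e he
    obtain ⟨i, j⟩ := e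
    have h := m.source_mem (i, j)
    cases T <;> simp [newPairs, nodes, waiting] at he h ⊢ <;> grind
  target_mem := by
    intro e he
    obtain ⟨i, j⟩ := e
    have h := m.target_mem (i, j)
    cases T <;> simp [newPairs, nodes, waiting] at he h ⊢ <;> grind
  loopless := by
    intro e he heq
    have h := m.loopless e
    have h' := m.fresh_notMem
    simp only [newPairs, nodes, waiting, Finset.mem_union, Finset.mem_inter, Finset.mem_product,
      Finset.mem_singleton] at he h' ⊢
    rcases he with he | ⟨-, ⟨h1, h2⟩ | ⟨h1, h2⟩⟩
    · exact h he heq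
    · rw [heq, h2] at h1
      exact h' h1
    · rw [← heq, h1] at h2
      exact h' (Or.inl h2)

/-- A feasible set `M` of transactions; `(i, j) ∈ M` means that `j` receives the item of `i`.
Items move along edges of the compatibility graph only, every agent gives at most once and receives
at most once, and whoever gives is a bridge agent or receives an item as well.  Such an `M` is
exactly a disjoint union of directed cycles of waiting agents and of directed paths (chain-segments)
that start at a bridge or altruistic agent. -/
structure Feasible (m : Market) (M : Finset (ℕ × ℕ)) : Prop where
  subset_edges : M ⊆ m.edges
  gives_once : ∀ e ∈ M, ∀ f ∈ M, e.1 = f.1 → e = f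
  receives_once : ∀ e ∈ M, ∀ f ∈ M, e.2 = f.2 → e = f
  giver : ∀ e ∈ M, e.1 ∈ m.bridges ∨ ∃ f ∈ M, f.2 = e.1

/-- The market after the transactions `M`: whoever receives an item stops waiting and departs, the
last agent of a chain-segment stays on as a bridge agent, and a bridge agent who gives is removed. -/
def execute (m : Market) (M : Finset (ℕ × ℕ)) : Market where
  hard := m.hard \ M.image Prod.snd
  easy := m.easy \ M.image Prod.snd
  bridges := (m.bridges ∪ M.image Prod.snd) \ M.image Prod.fst
  edges := m.edges.filter fun e =>
    e.1 ∈ ((m.hard \ M.image Prod.snd) ∪ (m.easy \ M.image Prod.snd)) ∪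
        ((m.bridges ∪ M.image Prod.snd) \ M.image Prod.fst) ∧
      e.2 ∈ (m.hard \ M.image Prod.snd) ∪ (m.easy \ M.image Prod.snd)
  disjoint_hard_easy := m.disjoint_hard_easy.mono Finset.sdiff_subset Finset.sdiff_subset
  disjoint_hard_bridges := by
    have h := m.disjoint_hard_bridges
    rw [Finset.disjoint_left] at h ⊢
    intro a ha hb
    rw [Finset.mem_sdiff] at ha hb
    exact (Finset.mem_union.1 hb.1).elim (h ha.1) ha.2
  disjoint_easy_bridges := by
    have h := m.disjoint_easy_bridges
    rw [Finset.disjoint_left] at h ⊢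
    intro a ha hb
    rw [Finset.mem_sdiff] at ha hb
    exact (Finset.mem_union.1 hb.1).elim (h ha.1) ha.2
  source_mem := fun _ he => (Finset.mem_filter.1 he).2.1
  target_mem := fun _ he => (Finset.mem_filter.1 he).2.2
  loopless := fun e he => m.loopless e (Finset.mem_filter.1 he).1

end Market

/-- The law of the random subset of `S` that contains each `e ∈ S` independently with
probability `p e`. -/
noncomputable def randomSubset {α : Type*} [DecidableEq α] (S : Finset α) (p : α → I) :
    PMF (Finset α) :=
  PMF.ofFinset
    (fun A => if A ⊆ S then
      ENNReal.ofReal ((∏ e ∈ A, (p e : ℝ)) * ∏ e ∈ S \ A, (1 - (p e : ℝ))) else 0)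
    S.powerset
    (by
      have h0 : ∀ A ∈ S.powerset,
          0 ≤ (∏ e ∈ A, (p e : ℝ)) * ∏ e ∈ S \ A, (1 - (p e : ℝ)) := fun A _ =>
        mul_nonneg (Finset.prod_nonneg fun e _ => (p e).2.1)
          (Finset.prod_nonneg fun e _ => sub_nonneg.2 (p e).2.2)
      rw [Finset.sum_congr rfl (fun A hA => if_pos (Finset.mem_powerset.1 hA)),
        ← ENNReal.ofReal_sum_of_nonneg h0, ← Finset.prod_add]
      simp)
    (by
      intro A hA
      rw [if_neg (by simpa using hA)])

/-- The type of an arriving agent: by superposition of the two independent Poisson processes it is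
`H` with probability `lamH / (lamH + lamE)`, independently of everything else.  (If both rates
vanish, nobody ever arrives and this law is immaterial.) -/
noncomputable def arrivalType (θ : Params) : PMF AgentType :=
  (PMF.ofFintype (fun b : Bool =>
      cond b ((θ.lamH / θ.totalRate : ℝ≥0) : ℝ≥0∞) ((1 - θ.lamH / θ.totalRate : ℝ≥0) : ℝ≥0∞))
    (by
      have h : θ.lamH / θ.totalRate ≤ 1 := div_le_one_of_le₀ (by simp [Params.totalRate]) (by simp)
      rw [Fintype.sum_bool, cond_true, cond_false, ← ENNReal.coe_add, add_tsub_cancel_of_le h,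
        ENNReal.coe_one])).map
    fun b => cond b AgentType.H AgentType.E

/-- The random market right after an agent of type `T` has arrived and before any matching: each
new pair `(i, j)` becomes an edge independently, with probability `pH` or `pE` according to the type
of the receiver `j`. -/
noncomputable def arrivalLaw (θ : Params) (T : AgentType) (m : Market) : PMF Market :=
  (randomSubset m.newPairs
      (fun e => if e.2 ∈ (m.arrive T ∅).hard then θ.pH else θ.pE)).map
    (m.arrive T)

/-- An anonymous Markovian matching policy: at every arrival epoch it selects, possibly at random, a
feasible set of exchanges as a function of the current compatibility graph (newcomer included), and
it commutes with every renaming of the agents (which preserves types). -/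
structure Policy where
  choose : Market → PMF (Finset (ℕ × ℕ))
  feasible : ∀ m, ∀ M ∈ (choose m).support, m.Feasible M
  anonymous : ∀ (g : Equiv.Perm ℕ) (m : Market),
    choose (m.relabel g) = (choose m).map (Finset.map (g.prodCongr g).toEmbedding)

/-- One arrival of an agent of type `T`, followed by the exchanges that the policy selects. -/
noncomputable def stepOfType (θ : Params) (P : Policy) (T : AgentType) (m : Market) : PMF Market :=
  (arrivalLaw θ T m).bind fun m' => (P.choose m').map m'.execute

/-- The transition law of the market at an arrival epoch. -/
noncomputable def step (θ : Params) (P : Policy) (m : Market) : PMF Market :=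
  (arrivalType θ).bind fun T => stepOfType θ P T m

/-- The law of the market after `k` arrivals, from `m`. -/
noncomputable def stepN (θ : Params) (P : Policy) (m : Market) : ℕ → PMF Market
  | 0 => PMF.pure m
  | k + 1 => (stepN θ P m k).bind (step θ P)

/-- The probability that exactly `k` agents arrive during a time span of length `t`. -/
noncomputable def arrivalsProb (θ : Params) (t : ℝ≥0) (k : ℕ) : ℝ≥0∞ :=
  poissonMeasure (θ.totalRate * t) {k}

/-- Transition function of the continuous-time chain of compatibility graphs up to isomorphism: the
probability that at time `t` the market is in the class `c` if it is `m` at time `0`.  The market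
changes at the epochs of a Poisson process only, where it moves according to `step`. -/
noncomputable def transition (θ : Params) (P : Policy) (t : ℝ≥0) (m : Market)
    (c : Market.IsoClass) : ℝ≥0∞ :=
  ∑' k, arrivalsProb θ t k * (stepN θ P m k).map Market.toClass c

/-- `ρ` represents the steady state of the policy `P` in a market with `d` altruistic agents: its
law on isomorphism classes is stationary (the generator of the continuous-time chain is the total
arrival rate times `step` minus the identity), and the market that starts with the `d` altruistic
agents alone converges to it in law as time goes to infinity. -/
structure IsSteadyState (θ : Params) (d : ℕ) (P : Policy) (ρ : PMF Market) : Prop where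
  stationary : (ρ.bind (step θ P)).map Market.toClass = ρ.map Market.toClass
  ergodic : ∀ c : Market.IsoClass,
    Tendsto (fun t : ℝ≥0 => transition θ P t (Market.initial d) c) atTop
      (𝓝 (ρ.map Market.toClass c))

/-- The probability that the agent named `a` is waiting in the market `m` and is still there after
each of the next `k` arrivals. -/
noncomputable def stillWaiting (θ : Params) (P : Policy) (a : ℕ) : ℕ → Market → ℝ≥0∞
  | 0, m => if a ∈ m.waiting then 1 else 0
  | k + 1, m =>
      if a ∈ m.waiting then ∑' m', step θ P m m' * stillWaiting θ P a k m' else 0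

/-- The probability that an agent of type `T` who arrives when the market has law `ρ` is still
waiting after her own arrival epoch and the next `k` arrivals. -/
noncomputable def newcomerStillWaiting (θ : Params) (P : Policy) (ρ : PMF Market) (T : AgentType)
    (k : ℕ) : ℝ≥0∞ :=
  ∑' m, ρ m * ∑' m', stepOfType θ P T m m' * stillWaiting θ P m.fresh k m'

/-- The probability that the waiting time (departure time minus arrival time) of an agent of type
`T` who arrives when the market has law `ρ` exceeds `t`. -/
noncomputable def waitTail (θ : Params) (P : Policy) (ρ : PMF Market) (T : AgentType) (t : ℝ≥0) :
    ℝ≥0∞ :=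
  ∑' k, arrivalsProb θ t k * newcomerStillWaiting θ P ρ T k

/-- The expected waiting time of an agent of type `T` who arrives in steady state, as the integral
of the tail probabilities; it is `0` if there are no agents of type `T`.  It may be infinite. -/
noncomputable def waitingTime (θ : Params) (P : Policy) (ρ : PMF Market) (T : AgentType) : ℝ≥0∞ :=
  if θ.rate T = 0 then 0 else ∫⁻ t in Set.Ioi (0 : ℝ), waitTail θ P ρ T t.toNNReal

end DynamicMatching

/-!
A hard-to-match newcomer can get a usable incoming edge only from a later newcomer, from one of the
`d` bridge agents (an exchange never changes their number), or from a waiting agent `x` who may ever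
leave: one who waits forever never gives her item.  Each of these edges is missing with probability
`1 - p`, so if `L` denotes the number of waiting agents who may ever leave, the newcomer is still
waiting `k` arrivals later with probability at least `(1 - p) ^ (k + d) * E[(1 - p) ^ L]`.  Summing
over `k` gives `λ * p * w_H ≥ (1 - p) ^ d * E[(1 - p) ^ L]`, where `λ` is the total arrival rate.

On the other hand `E[L] ≤ λ * (w_H + w_E)` by Little's law, so that
`E[(1 - p) ^ L] ≥ 1 - p * λ * (w_H + w_E)` by Bernoulli's inequality.  The two estimates together
force `w_H + w_E` to be at least of order `1 / p`.

Little's law only counts agents who arrive in the course of time, while a steady state may contain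
agents who have always been there and never leave.  If newcomers have finite mean sojourn, a
zero–one law shows that each agent present in steady state either almost surely leaves or almost
surely stays forever; those who may leave are thus certain to do so, and Little's law applies to
them.
-/

namespace DynamicMatching

/-! ### Expectations under probability mass functions -/

/-- The expectation of a `ℝ≥0∞`-valued function under a probability mass function, as a sum: it
needs no σ-algebra and unfolds to the sums that define `stillWaiting`. -/
noncomputable def expect {α : Type*} (μ : PMF α) (f : α → ℝ≥0∞) : ℝ≥0∞ := ∑' x, μ x * f x

section Expect

variable {α β : Type*} {μ : PMF α} {f g : α → ℝ≥0∞} {c : ℝ≥0∞}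

theorem expect_pure (a : α) (f : α → ℝ≥0∞) : expect (PMF.pure a) f = f a := by
  rw [expect, tsum_eq_single a fun b hb => by rw [PMF.pure_apply_of_ne _ _ hb, zero_mul],
    PMF.pure_apply_self, one_mul]

theorem expect_bind (μ : PMF α) (κ : α → PMF β) (f : β → ℝ≥0∞) :
    expect (μ.bind κ) f = expect μ fun x => expect (κ x) f := by
  simp only [expect, PMF.bind_apply, ← ENNReal.tsum_mul_right, ← ENNReal.tsum_mul_left, mul_assoc]
  exact ENNReal.tsum_comm

theorem expect_map (μ : PMF α) (g : α → β) (f : β → ℝ≥0∞) :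
    expect (μ.map g) f = expect μ fun x => f (g x) := by
  simp only [← PMF.bind_pure_comp, expect_bind, Function.comp_apply, expect_pure]

theorem expect_const (μ : PMF α) (c : ℝ≥0∞) : expect μ (fun _ => c) = c := by
  rw [expect, ENNReal.tsum_mul_right, PMF.tsum_coe, one_mul]

theorem expect_add (μ : PMF α) (f g : α → ℝ≥0∞) :
    expect μ (fun x => f x + g x) = expect μ f + expect μ g := by
  simp only [expect, mul_add, ENNReal.tsum_add]

theorem expect_mul_left (μ : PMF α) (c : ℝ≥0∞) (f : α → ℝ≥0∞) :
    expect μ (fun x => c * f x) = c * expect μ f := by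
  simp only [expect, mul_left_comm _ c, ENNReal.tsum_mul_left]

theorem expect_finset_sum {ι : Type*} (μ : PMF α) (s : Finset ι) (f : ι → α → ℝ≥0∞) :
    expect μ (fun x => ∑ i ∈ s, f i x) = ∑ i ∈ s, expect μ (f i) := by
  simp only [expect, Finset.mul_sum]
  exact Summable.tsum_finsetSum fun _ _ => ENNReal.summable

theorem expect_tsum {ι : Type*} (μ : PMF α) (f : ι → α → ℝ≥0∞) :
    expect μ (fun x => ∑' i, f i x) = ∑' i, expect μ (f i) := by
  simp only [expect, ← ENNReal.tsum_mul_left]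
  exact ENNReal.tsum_comm

theorem expect_comm (μ : PMF α) (ν : PMF β) (f : α → β → ℝ≥0∞) :
    expect μ (fun x => expect ν (f x)) = expect ν fun y => expect μ fun x => f x y := by
  simp only [expect, ← ENNReal.tsum_mul_left, mul_left_comm (μ _)]
  exact ENNReal.tsum_comm

theorem expect_mono (h : ∀ x ∈ μ.support, f x ≤ g x) : expect μ f ≤ expect μ g := by
  refine ENNReal.tsum_le_tsum fun x => ?_
  by_cases hx : x ∈ μ.support
  · exact mul_le_mul_right (h x hx) _
  · simp only [(PMF.apply_eq_zero_iff μ x).2 hx, zero_mul, le_refl]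

theorem expect_le_of_le (h : ∀ x ∈ μ.support, f x ≤ c) : expect μ f ≤ c :=
  (expect_mono h).trans_eq (expect_const μ c)

theorem le_expect_of_le (h : ∀ x ∈ μ.support, c ≤ f x) : c ≤ expect μ f :=
  (expect_const μ c).symm.trans_le (expect_mono h)

theorem eq_zero_of_expect_eq_zero (h : expect μ f = 0) {x : α} (hx : x ∈ μ.support) : f x = 0 :=
  (mul_eq_zero.1 (ENNReal.tsum_eq_zero.1 h x)).resolve_left ((PMF.mem_support_iff _ _).1 hx)

theorem eq_of_expect_eq (hf : ∀ x, f x ≤ c) (hc : c ≠ ∞) (h : expect μ f = c) {x : α}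
    (hx : x ∈ μ.support) : f x = c := by
  have hgap : c + expect μ (fun x => c - f x) = c + 0 := by
    conv_lhs => rw [← h]
    rw [← expect_add]
    simp only [add_tsub_cancel_of_le (hf _), h, expect_const, add_zero]
  exact (hf x).antisymm <| tsub_eq_zero_iff_le.1 <|
    eq_zero_of_expect_eq_zero ((ENNReal.add_right_inj hc).1 hgap) hx

theorem mul_toOuterMeasure_le_expect (s : Set α) (h : ∀ x ∈ μ.support, x ∈ s → c ≤ f x) :
    c * μ.toOuterMeasure s ≤ expect μ f := by
  rw [PMF.toOuterMeasure_apply, ← ENNReal.tsum_mul_left]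
  refine ENNReal.tsum_le_tsum fun x => ?_
  by_cases hx : x ∈ s ∩ μ.support
  · rw [Set.indicator_of_mem hx.1, mul_comm]
    exact mul_le_mul_right (h x hx.2 hx.1) _
  · have h0 : s.indicator μ x = 0 := by
      by_contra h0
      exact hx ⟨Set.mem_of_indicator_ne_zero h0, fun hx0 => h0 (Set.indicator_apply_eq_zero.2
        fun _ => hx0)⟩
    simp only [h0, mul_zero, zero_le]

theorem tendsto_expect (μ : PMF α) {F : ℕ → α → ℝ≥0∞} (hc : c ≠ ∞) (hF : ∀ n x, F n x ≤ c)
    (h : ∀ x, Tendsto (fun n => F n x) atTop (𝓝 (f x))) :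
    Tendsto (fun n => expect μ (F n)) atTop (𝓝 (expect μ f)) := by
  let _ : MeasurableSpace α := ⊤
  simp only [expect, ← lintegral_count]
  refine tendsto_lintegral_of_dominated_convergence (fun x => μ x * c)
    (fun _ => measurable_from_top)
    (fun n => Eventually.of_forall fun x => mul_le_mul_right (hF n x) _) ?_
    (Eventually.of_forall fun x => ENNReal.Tendsto.const_mul (h x) (Or.inr (μ.apply_ne_top x)))
  rw [lintegral_count, ENNReal.tsum_mul_right, PMF.tsum_coe, one_mul]
  exact hc

theorem expect_le_of_forall_min_le {b : ℝ≥0∞}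
    (h : ∀ c ≠ ∞, expect μ (fun x => min c (f x)) ≤ b) : expect μ f ≤ b := by
  let _ : MeasurableSpace α := ⊤
  have hlim : Tendsto (fun n : ℕ => expect μ fun x => min (n : ℝ≥0∞) (f x)) atTop
      (𝓝 (expect μ f)) := by
    simp only [expect, ← lintegral_count]
    refine lintegral_tendsto_of_tendsto_of_monotone (fun _ => measurable_from_top.aemeasurable)
      (Eventually.of_forall fun x m n hmn =>
        mul_le_mul_right (min_le_min_right _ (Nat.mono_cast hmn)) _)
      (Eventually.of_forall fun x => ENNReal.Tendsto.const_mul ?_ (Or.inr (μ.apply_ne_top x)))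
    simpa only [top_inf_eq] using ENNReal.tendsto_nat_nhds_top.min (tendsto_const_nhds (x := f x))
  exact le_of_tendsto' hlim fun n => h n (ENNReal.natCast_ne_top n)

end Expect

/-! ### Random subsets -/

section RandomSubset

variable {α β : Type*} [DecidableEq α] [DecidableEq β]

theorem randomSubset_apply_of_subset {S A : Finset α} (p : α → I) (h : A ⊆ S) :
    randomSubset S p A =
      ENNReal.ofReal ((∏ e ∈ A, (p e : ℝ)) * ∏ e ∈ S \ A, (1 - (p e : ℝ))) :=
  if_pos h

theorem randomSubset_apply_of_not_subset {S A : Finset α} (p : α → I) (h : ¬ A ⊆ S) :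
    randomSubset S p A = 0 :=
  if_neg h

theorem toOuterMeasure_randomSubset_disjoint {S B : Finset α} (p : α → I) (hB : B ⊆ S) :
    (randomSubset S p).toOuterMeasure {A | Disjoint A B} =
      ENNReal.ofReal (∏ e ∈ B, (1 - (p e : ℝ))) := by
  have hsupp : ∀ A ∉ (S \ B).powerset, {A | Disjoint A B}.indicator (randomSubset S p) A = 0 := by
    intro A hA
    refine Set.indicator_apply_eq_zero.2 fun hAB => randomSubset_apply_of_not_subset p fun hAS => ?_
    exact hA (Finset.mem_powerset.2 (Finset.subset_sdiff.2 ⟨hAS, hAB⟩))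
  have hterm : ∀ A ∈ (S \ B).powerset, {A | Disjoint A B}.indicator (randomSubset S p) A =
      ENNReal.ofReal ((∏ e ∈ B, (1 - (p e : ℝ))) *
        ((∏ e ∈ A, (p e : ℝ)) * ∏ e ∈ (S \ B) \ A, (1 - (p e : ℝ)))) := by
    intro A hA
    obtain ⟨hAS, hAB⟩ := Finset.subset_sdiff.1 (Finset.mem_powerset.1 hA)
    have hBSA : B ⊆ S \ A := Finset.subset_sdiff.2 ⟨hB, hAB.symm⟩
    rw [Set.indicator_of_mem hAB, randomSubset_apply_of_subset p hAS,
      ← Finset.prod_sdiff hBSA, sdiff_right_comm]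
    ring_nf
  have hnonneg : ∀ A : Finset α, 0 ≤ (∏ e ∈ B, (1 - (p e : ℝ))) *
      ((∏ e ∈ A, (p e : ℝ)) * ∏ e ∈ (S \ B) \ A, (1 - (p e : ℝ))) := fun A =>
    mul_nonneg (Finset.prod_nonneg fun e _ => sub_nonneg.2 (p e).2.2) <|
      mul_nonneg (Finset.prod_nonneg fun e _ => (p e).2.1)
        (Finset.prod_nonneg fun e _ => sub_nonneg.2 (p e).2.2)
  rw [PMF.toOuterMeasure_apply, tsum_eq_sum hsupp, Finset.sum_congr rfl hterm,
    ← ENNReal.ofReal_sum_of_nonneg fun A _ => hnonneg A, ← Finset.mul_sum, ← Finset.prod_add]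
  simp only [add_sub_cancel, Finset.prod_const_one, mul_one]

theorem randomSubset_map_embedding (S : Finset α) {p : α → I} {p' : β → I} (g : α ↪ β)
    (h : ∀ e ∈ S, p' (g e) = p e) :
    randomSubset (S.map g) p' = (randomSubset S p).map (Finset.map g) := by
  refine PMF.ext fun A => ?_
  rw [PMF.map_apply]
  by_cases hA : A ⊆ S.map g
  · obtain ⟨A, hAS, rfl⟩ := Finset.subset_map_iff.1 hA
    have hin : ∏ e ∈ A, (p' (g e) : ℝ) = ∏ e ∈ A, (p e : ℝ) :=
      Finset.prod_congr rfl fun e he => by rw [h e (hAS he)]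
    have hout : ∏ e ∈ S \ A, (1 - (p' (g e) : ℝ)) = ∏ e ∈ S \ A, (1 - (p e : ℝ)) :=
      Finset.prod_congr rfl fun e he => by rw [h e (Finset.mem_sdiff.1 he).1]
    refine Eq.trans ?_ ((tsum_eq_single A fun B hB =>
      if_neg fun h => hB (Finset.map_injective g h).symm).trans (if_pos rfl)).symm
    rw [randomSubset_apply_of_subset p' hA, randomSubset_apply_of_subset p hAS, ← Finset.map_sdiff,
      Finset.prod_map, Finset.prod_map, hin, hout]
  · rw [randomSubset_apply_of_not_subset p' hA, eq_comm, ENNReal.tsum_eq_zero]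
    intro B
    split_ifs with hAB
    · exact randomSubset_apply_of_not_subset p fun hBS => hA (hAB ▸ Finset.map_subset_map.2 hBS)
    · rfl

end RandomSubset

/-! ### Populations with arrivals -/

/-- A Markov chain whose state carries a finite population of named individuals.  At each step one
newcomer, whose name is not in use, joins and some individuals leave.  The dynamics do not depend on
the names, except that the newcomer's name is a function of the state: the transition law therefore
commutes with a renaming only after that renaming has been altered outside the population. -/
structure PopulationChain (S ι : Type*) [DecidableEq ι] where
  kernel : S → PMF S
  pop : S → Finset ι
  newcomer : S → ι
  relabel : Equiv.Perm ι → S → S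
  newcomer_notMem : ∀ m, newcomer m ∉ pop m
  pop_subset : ∀ m, ∀ m' ∈ (kernel m).support, pop m' ⊆ insert (newcomer m) (pop m)
  pop_relabel : ∀ g m, pop (relabel g m) = (pop m).map g.toEmbedding
  kernel_relabel : ∀ g m, ∃ g' : Equiv.Perm ι, (∀ a ∈ pop m, g' a = g a) ∧
    kernel (relabel g m) = (kernel m).map (relabel g')

namespace PopulationChain

variable {S ι : Type*} [DecidableEq ι] (C : PopulationChain S ι)

/-- The indicator of the individuals who are present. -/
def present (m : S) (a : ι) : ℝ≥0∞ := if a ∈ C.pop m then 1 else 0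

/-- The expectation of `r` for the individual `a` after the next step, if she is present before
it. -/
noncomputable def survive (r : S → ι → ℝ≥0∞) (m : S) (a : ι) : ℝ≥0∞ :=
  if a ∈ C.pop m then expect (C.kernel m) (r · a) else 0

/-- The probability that `a` is present now and after each of the next `k` steps. -/
noncomputable def stillPresent (k : ℕ) : S → ι → ℝ≥0∞ := C.survive^[k] C.present

/-- The probability that `a` is present and never leaves. -/
noncomputable def staysForever : S → ι → ℝ≥0∞ := ⨅ k, C.stillPresent k

/-- The individual `a` is present and almost surely never leaves. -/
def Permanent (m : S) (a : ι) : Prop := C.staysForever m a = 1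

open Classical in
/-- The individuals present who may leave. -/
noncomputable def leavers (m : S) : Finset ι := (C.pop m).filter (¬ C.Permanent m ·)

/-- Quantities attached to the individuals that do not depend on names. -/
def NameInvariant (r : S → ι → ℝ≥0∞) : Prop :=
  ∀ (g : Equiv.Perm ι) (m : S) (a : ι), r (C.relabel g m) (g a) = r m a

/-- The total of `r` over the population. -/
noncomputable def popSum (r : S → ι → ℝ≥0∞) (m : S) : ℝ≥0∞ := ∑ a ∈ C.pop m, r m a

/-- The expectation of `r` for the next newcomer just after she has joined, when the state has law
`ρ`. -/
noncomputable def newcomerMean (ρ : PMF S) (r : S → ι → ℝ≥0∞) : ℝ≥0∞ :=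
  expect ρ fun m => expect (C.kernel m) (r · (C.newcomer m))

/-- The expected number of steps after which the next newcomer is still present, when the state has
law `ρ`; her own step counts. -/
noncomputable def meanSojourn (ρ : PMF S) : ℝ≥0∞ := ∑' k, C.newcomerMean ρ (C.stillPresent k)

/-- Stationarity up to names: one step does not change the expectation of any function of the state
that is invariant under renaming. -/
def Stationary (ρ : PMF S) : Prop :=
  ∀ f : S → ℝ≥0∞, (∀ g m, f (C.relabel g m) = f m) → expect (ρ.bind C.kernel) f = expect ρ f

variable {C} {r : S → ι → ℝ≥0∞} {m m' : S} {a : ι} {ρ : PMF S}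

theorem survive_mono : Monotone C.survive := fun r r' h m a => by
  unfold survive
  split_ifs
  exacts [expect_mono fun m' _ => h m' a, le_rfl]

theorem survive_add (r r' : S → ι → ℝ≥0∞) : C.survive (r + r') = C.survive r + C.survive r' := by
  funext m a
  simp only [Pi.add_apply, survive]
  split_ifs
  exacts [expect_add _ _ _, (add_zero 0).symm]

theorem iterate_survive_mono (k : ℕ) : Monotone (C.survive^[k]) := survive_mono.iterate k

theorem iterate_survive_add (k : ℕ) (r r' : S → ι → ℝ≥0∞) :
    C.survive^[k] (r + r') = C.survive^[k] r + C.survive^[k] r' :=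
  Function.Semiconj₂.iterate survive_add k r r'

theorem present_of_mem (h : a ∈ C.pop m) : C.present m a = 1 := if_pos h

theorem present_le_one (m : S) (a : ι) : C.present m a ≤ 1 :=
  ite_le_one le_rfl zero_le_one

theorem survive_present_le : C.survive C.present ≤ C.present := fun m a => by
  unfold survive
  split_ifs with h
  · exact (expect_le_of_le fun m' _ => present_le_one m' a).trans_eq (present_of_mem h).symm
  · exact zero_le

theorem stillPresent_antitone : Antitone C.stillPresent :=
  survive_mono.antitone_iterate_of_map_le survive_present_le

theorem stillPresent_le_present (k : ℕ) : C.stillPresent k ≤ C.present :=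
  stillPresent_antitone k.zero_le

theorem staysForever_le_stillPresent (k : ℕ) : C.staysForever ≤ C.stillPresent k := iInf_le _ k

theorem staysForever_le_one (m : S) (a : ι) : C.staysForever m a ≤ 1 :=
  (staysForever_le_stillPresent 0 m a).trans (present_le_one m a)

theorem staysForever_ne_top (m : S) (a : ι) : C.staysForever m a ≠ ∞ :=
  ne_top_of_le_ne_top ENNReal.one_ne_top (staysForever_le_one m a)

theorem tendsto_stillPresent (m : S) (a : ι) :
    Tendsto (fun k => C.stillPresent k m a) atTop (𝓝 (C.staysForever m a)) := by
  simp only [staysForever, iInf_apply]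
  exact tendsto_atTop_iInf fun _ _ h => stillPresent_antitone h m a

theorem Permanent.mem_pop (h : C.Permanent m a) : a ∈ C.pop m := by
  by_contra ha
  have h0 : C.staysForever m a ≤ 0 :=
    (staysForever_le_stillPresent 0 m a).trans_eq (if_neg ha)
  exact one_ne_zero (h.symm.trans (le_zero_iff.1 h0))

theorem survive_staysForever : C.survive C.staysForever = C.staysForever := by
  funext m a
  refine tendsto_nhds_unique (f := fun k => C.survive (C.stillPresent k) m a) (l := atTop) ?_ ?_
  · unfold survive
    split_ifs
    · exact tendsto_expect _ ENNReal.one_ne_top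
        (fun k m' => (stillPresent_le_present k m' a).trans (present_le_one m' a))
        fun m' => tendsto_stillPresent m' a
    · exact tendsto_const_nhds
  · simp only [stillPresent, ← Function.iterate_succ_apply' C.survive]
    exact (tendsto_stillPresent m a).comp (tendsto_add_atTop_nat 1)

theorem iterate_survive_staysForever (k : ℕ) : C.survive^[k] C.staysForever = C.staysForever :=
  Function.iterate_fixed survive_staysForever k

theorem Permanent.of_mem_support (h : C.Permanent m a) (hm' : m' ∈ (C.kernel m).support) :
    C.Permanent m' a := by
  refine eq_of_expect_eq (staysForever_le_one · a) ENNReal.one_ne_top ?_ hm'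
  rw [← h, ← survive_staysForever, survive, if_pos h.mem_pop, survive_staysForever]

theorem tendsto_iterate_survive (hr : r + C.staysForever ≤ C.present) (m : S) (a : ι) :
    Tendsto (fun k => C.survive^[k] r m a) atTop (𝓝 0) := by
  have hle : ∀ k, C.survive^[k] r m a ≤ C.stillPresent k m a - C.staysForever m a := fun k => by
    have h := iterate_survive_mono (C := C) k hr m a
    rw [iterate_survive_add, iterate_survive_staysForever] at h
    exact ENNReal.le_sub_of_add_le_right (staysForever_ne_top m a) h
  have hlim : Tendsto (fun k => C.stillPresent k m a - C.staysForever m a) atTop (𝓝 0) := by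
    rw [← tsub_self (C.staysForever m a)]
    exact ENNReal.Tendsto.sub (tendsto_stillPresent m a) tendsto_const_nhds
      (Or.inl (staysForever_ne_top m a))
  exact tendsto_of_tendsto_of_tendsto_of_le_of_le tendsto_const_nhds hlim (fun _ => zero_le) hle

theorem nameInvariant_present : C.NameInvariant C.present := fun g m a => by
  simp only [present, C.pop_relabel, Finset.mem_map_equiv, Equiv.symm_apply_apply]

theorem NameInvariant.survive (hr : C.NameInvariant r) : C.NameInvariant (C.survive r) :=
  fun g m a => by
  obtain ⟨g', hg', hker⟩ := C.kernel_relabel g m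
  simp only [PopulationChain.survive, C.pop_relabel, Finset.mem_map_equiv, Equiv.symm_apply_apply]
  refine ite_congr rfl (fun ha => ?_) fun _ => rfl
  simp only [hker, expect_map, ← hg' a ha, hr g' _ a]

theorem NameInvariant.iterate_survive (hr : C.NameInvariant r) (k : ℕ) :
    C.NameInvariant (C.survive^[k] r) := by
  induction k with
  | zero => exact hr
  | succ k ih =>
    rw [Function.iterate_succ_apply']
    exact ih.survive

theorem nameInvariant_staysForever : C.NameInvariant C.staysForever := fun g m a => by
  simp only [staysForever, iInf_apply]
  exact iInf_congr fun k => nameInvariant_present.iterate_survive k g m a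

theorem popSum_relabel (hr : C.NameInvariant r) (g : Equiv.Perm ι) (m : S) :
    C.popSum r (C.relabel g m) = C.popSum r m := by
  rw [popSum, C.pop_relabel, Finset.sum_map]
  exact Finset.sum_congr rfl fun a _ => hr g m a

theorem newcomerMean_mono (ρ : PMF S) : Monotone (C.newcomerMean ρ) := fun _ _ h =>
  expect_mono fun m _ => expect_mono fun m' _ => h m' (C.newcomer m)

theorem expect_kernel_popSum_le (r : S → ι → ℝ≥0∞) (m : S) :
    expect (C.kernel m) (C.popSum r) ≤
      C.popSum (C.survive r) m + expect (C.kernel m) (r · (C.newcomer m)) := by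
  calc expect (C.kernel m) (C.popSum r)
      ≤ expect (C.kernel m) (fun m' => ∑ a ∈ insert (C.newcomer m) (C.pop m), r m' a) :=
        expect_mono fun m' hm' => Finset.sum_le_sum_of_subset (C.pop_subset m m' hm')
    _ = (∑ a ∈ C.pop m, expect (C.kernel m) (r · a)) +
          expect (C.kernel m) (r · (C.newcomer m)) := by
        rw [expect_finset_sum, Finset.sum_insert (C.newcomer_notMem m), add_comm]
    _ = C.popSum (C.survive r) m + expect (C.kernel m) (r · (C.newcomer m)) := by
        rw [popSum, Finset.sum_congr rfl fun a ha => (if_pos ha).symm]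
        rfl

theorem expect_min_popSum_le_survive (hρ : C.Stationary ρ) (hr : C.NameInvariant r) (c : ℝ≥0∞) :
    expect ρ (fun m => min c (C.popSum r m)) ≤
      expect ρ (fun m => min c (C.popSum (C.survive r) m)) + C.newcomerMean ρ r := by
  rw [← hρ _ fun g m => congrArg (min c) (popSum_relabel hr g m), expect_bind, newcomerMean,
    ← expect_add]
  refine expect_mono fun m _ => ?_
  calc expect (C.kernel m) (fun m' => min c (C.popSum r m'))
      ≤ min c (expect (C.kernel m) (C.popSum r)) :=
        le_min (expect_le_of_le fun _ _ => min_le_left _ _)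
          (expect_mono fun _ _ => min_le_right _ _)
    _ ≤ min (c + expect (C.kernel m) (r · (C.newcomer m)))
          (C.popSum (C.survive r) m + expect (C.kernel m) (r · (C.newcomer m))) :=
        min_le_min le_self_add (expect_kernel_popSum_le r m)
    _ = min c (C.popSum (C.survive r) m) + expect (C.kernel m) (r · (C.newcomer m)) :=
        min_add_add_right _ _ _

theorem expect_min_popSum_le_iterate (hρ : C.Stationary ρ) (hr : C.NameInvariant r) (c : ℝ≥0∞)
    (k : ℕ) :
    expect ρ (fun m => min c (C.popSum r m)) ≤
      expect ρ (fun m => min c (C.popSum (C.survive^[k] r) m)) +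
        ∑ j ∈ Finset.range k, C.newcomerMean ρ (C.survive^[j] r) := by
  induction k with
  | zero => simp only [Function.iterate_zero, id_eq, Finset.range_zero, Finset.sum_empty, add_zero,
      le_refl]
  | succ k ih =>
    rw [Finset.sum_range_succ, add_comm (∑ j ∈ _, _), ← add_assoc, Function.iterate_succ_apply']
    exact ih.trans (add_le_add_left (expect_min_popSum_le_survive hρ (hr.iterate_survive k) c) _)

/-- The truncation at `c` supplies the integrability that lets the contribution of the individuals
initially present vanish in the limit; it is removed only afterwards. -/
theorem expect_popSum_le_tsum (hρ : C.Stationary ρ) (hinv : C.NameInvariant r)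
    (hr : r + C.staysForever ≤ C.present) :
    expect ρ (C.popSum r) ≤ ∑' j, C.newcomerMean ρ (C.survive^[j] r) := by
  refine expect_le_of_forall_min_le fun c hc => ?_
  have hpop : ∀ m, Tendsto (fun k => C.popSum (C.survive^[k] r) m) atTop (𝓝 0) := fun m => by
    simpa only [popSum, Finset.sum_const_zero] using
      tendsto_finsetSum (C.pop m) fun a _ => tendsto_iterate_survive hr m a
  have hlim : Tendsto (fun k => expect ρ fun m => min c (C.popSum (C.survive^[k] r) m)) atTop
      (𝓝 0) := by
    rw [← expect_const ρ 0]
    refine tendsto_expect ρ hc (fun _ _ => min_le_left _ _) fun m => ?_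
    simpa only [min_zero] using (tendsto_const_nhds (x := c)).min (hpop m)
  have hbound := hlim.add_const (∑' j, C.newcomerMean ρ (C.survive^[j] r))
  rw [zero_add] at hbound
  exact ge_of_tendsto' hbound fun k => (expect_min_popSum_le_iterate hρ hinv c k).trans
    (add_le_add_right (ENNReal.sum_le_tsum _) _)

theorem newcomerMean_staysForever (h : C.meanSojourn ρ ≠ ∞) :
    C.newcomerMean ρ C.staysForever = 0 :=
  le_zero_iff.1 <| ge_of_tendsto' (ENNReal.tendsto_atTop_zero_of_tsum_ne_top h) fun k =>
    newcomerMean_mono ρ (staysForever_le_stillPresent k)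

/-- The quantity `h (1 - h)`, where `h` is the probability of staying forever, dies out along every
trajectory, and newcomers carry none of it. -/
theorem staysForever_eq_zero_or_permanent (hρ : C.Stationary ρ) (h : C.meanSojourn ρ ≠ ∞)
    (hm : m ∈ ρ.support) (ha : a ∈ C.pop m) : C.staysForever m a = 0 ∨ C.Permanent m a := by
  set r : S → ι → ℝ≥0∞ := C.staysForever * (C.present - C.staysForever)
  have hinv : C.NameInvariant r := fun g m a => congrArg₂ (· * ·)
    (nameInvariant_staysForever g m a)
    (congrArg₂ (· - ·) (nameInvariant_present g m a) (nameInvariant_staysForever g m a))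
  have hdies : r + C.staysForever ≤ C.present := fun m a =>
    (add_le_add_left (mul_le_of_le_one_left zero_le (staysForever_le_one m a)) _).trans_eq
      (tsub_add_cancel_of_le (staysForever_le_stillPresent 0 m a))
  have hrle : r ≤ C.staysForever := fun m a =>
    mul_le_of_le_one_right zero_le (tsub_le_self.trans (present_le_one m a))
  have hnew : ∀ j, C.newcomerMean ρ (C.survive^[j] r) = 0 := fun j =>
    le_zero_iff.1 <| newcomerMean_staysForever h ▸ newcomerMean_mono ρ
      ((iterate_survive_mono j hrle).trans_eq (iterate_survive_staysForever j))
  have hsum : expect ρ (C.popSum r) = 0 :=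
    le_zero_iff.1 <| (expect_popSum_le_tsum hρ hinv hdies).trans_eq (ENNReal.tsum_eq_zero.2 hnew)
  have hra : r m a = 0 := Finset.sum_eq_zero_iff.1 (eq_zero_of_expect_eq_zero hsum hm) a ha
  refine (mul_eq_zero.1 hra).imp_right fun h1 => (staysForever_le_one m a).antisymm ?_
  exact (present_of_mem ha).symm.trans_le (tsub_eq_zero_iff_le.1 h1)

theorem popSum_present_sub_staysForever
    (h : ∀ a ∈ C.pop m, C.staysForever m a = 0 ∨ C.Permanent m a) :
    C.popSum (C.present - C.staysForever) m = (C.leavers m).card := by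
  classical
  rw [leavers, Finset.card_filter, Nat.cast_sum, popSum]
  refine Finset.sum_congr rfl fun a ha => ?_
  rw [Pi.sub_apply, Pi.sub_apply, present_of_mem ha]
  rcases h a ha with h0 | h1
  · simp [Permanent, h0]
  · rw [if_neg (not_not.2 h1), h1, tsub_self, Nat.cast_zero]

theorem expect_card_leavers_le (hρ : C.Stationary ρ) :
    expect ρ (fun m => (C.leavers m).card) ≤ C.meanSojourn ρ := by
  by_cases hfin : C.meanSojourn ρ = ∞
  · exact hfin ▸ le_top
  have hinv : C.NameInvariant (C.present - C.staysForever) := fun g m a =>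
    congrArg₂ (· - ·) (nameInvariant_present g m a) (nameInvariant_staysForever g m a)
  calc expect ρ (fun m => (C.leavers m).card)
      ≤ expect ρ (C.popSum (C.present - C.staysForever)) :=
        expect_mono fun m hm => (popSum_present_sub_staysForever fun a ha =>
          staysForever_eq_zero_or_permanent hρ hfin hm ha).ge
    _ ≤ ∑' j, C.newcomerMean ρ (C.survive^[j] (C.present - C.staysForever)) :=
        expect_popSum_le_tsum hρ hinv
          (tsub_add_cancel_of_le (staysForever_le_stillPresent 0)).le
    _ ≤ C.meanSojourn ρ := ENNReal.tsum_le_tsum fun j =>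
        newcomerMean_mono ρ (iterate_survive_mono j tsub_le_self)

end PopulationChain

/-! ### Poisson arrivals -/

theorem poissonMeasure_singleton_eq_gammaPDF {r : ℝ≥0} (hr : 0 < r) {t : ℝ} (ht : 0 ≤ t) (k : ℕ) :
    poissonMeasure (r * t.toNNReal) {k} = (r : ℝ≥0∞)⁻¹ * gammaPDF (k + 1) r t := by
  have hr' : (0 : ℝ) < r := hr
  have hpow : (r : ℝ) ^ (k + 1 : ℝ) = r ^ (k + 1) := mod_cast Real.rpow_natCast r (k + 1)
  rw [poissonMeasure_singleton, gammaPDF_of_nonneg ht, ← ENNReal.ofReal_coe_nnreal,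
    ← ENNReal.ofReal_inv_of_pos hr', ← ENNReal.ofReal_mul (by positivity), NNReal.coe_mul,
    Real.coe_toNNReal t ht, Real.Gamma_nat_eq_factorial, add_sub_cancel_right, Real.rpow_natCast,
    hpow]
  congr 1
  field_simp
  ring

theorem lintegral_poissonMeasure_singleton {r : ℝ≥0} (hr : 0 < r) (k : ℕ) :
    ∫⁻ t in Set.Ioi (0 : ℝ), poissonMeasure (r * t.toNNReal) {k} = (r : ℝ≥0∞)⁻¹ := by
  have hgamma : ∫⁻ t in Set.Ioi (0 : ℝ), gammaPDF (k + 1) r t = 1 := by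
    have hsplit := lintegral_add_compl (μ := volume) (gammaPDF (k + 1) r)
      (measurableSet_Ici (a := (0 : ℝ)))
    rwa [Set.compl_Ici, lintegral_gammaPDF_of_nonpos le_rfl, add_zero,
      lintegral_gammaPDF_eq_one (a := k + 1) (r := r) (by positivity) hr,
      setLIntegral_congr Ioi_ae_eq_Ici.symm] at hsplit
  rw [setLIntegral_congr_fun measurableSet_Ioi fun t ht =>
    poissonMeasure_singleton_eq_gammaPDF hr (le_of_lt ht) k,
    lintegral_const_mul' _ _ (by simpa using hr.ne'), hgamma, mul_one]

theorem measurable_poissonMeasure_singleton (r : ℝ≥0) (k : ℕ) :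
    Measurable fun t : ℝ => poissonMeasure (r * t.toNNReal) {k} := by
  simp only [poissonMeasure_singleton]
  fun_prop

theorem Params.totalRate_pos {θ : Params} {T : AgentType} (hT : θ.rate T ≠ 0) :
    0 < θ.totalRate := by
  cases T
  exacts [(pos_iff_ne_zero.2 hT).trans_le le_self_add, (pos_iff_ne_zero.2 hT).trans_le le_add_self]

theorem tsum_newcomerStillWaiting (P : Policy) (ρ : PMF Market) {θ : Params} {T : AgentType}
    (hT : θ.rate T ≠ 0) :
    ∑' k, newcomerStillWaiting θ P ρ T k = θ.totalRate * waitingTime θ P ρ T := by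
  have hpos : 0 < θ.totalRate := θ.totalRate_pos hT
  have hmeas := measurable_poissonMeasure_singleton θ.totalRate
  have hwait : waitingTime θ P ρ T =
      (θ.totalRate : ℝ≥0∞)⁻¹ * ∑' k, newcomerStillWaiting θ P ρ T k := by
    rw [waitingTime, if_neg hT]
    simp only [waitTail, arrivalsProb]
    rw [lintegral_tsum fun k => ((hmeas k).mul_const _).aemeasurable]
    simp only [lintegral_mul_const _ (hmeas _), lintegral_poissonMeasure_singleton hpos,
      ENNReal.tsum_mul_left]
  rw [hwait, ENNReal.mul_inv_cancel_left (ENNReal.coe_ne_zero.2 hpos.ne') ENNReal.coe_ne_top]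

/-! ### Renaming the agents -/

namespace Market

variable {m : Market} {g : Equiv.Perm ℕ}

theorem waiting_relabel (g : Equiv.Perm ℕ) (m : Market) :
    (m.relabel g).waiting = m.waiting.map g.toEmbedding :=
  (Finset.map_union _ _).symm

theorem nodes_relabel (g : Equiv.Perm ℕ) (m : Market) :
    (m.relabel g).nodes = m.nodes.map g.toEmbedding := by
  rw [nodes, waiting_relabel, nodes, Finset.map_union, relabel]

theorem fresh_notMem_waiting (m : Market) : m.fresh ∉ m.waiting := fun h =>
  m.fresh_notMem (Finset.mem_union_left _ h)

theorem relabel_congr {g' : Equiv.Perm ℕ} (h : ∀ a ∈ m.nodes, g a = g' a) :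
    m.relabel g = m.relabel g' := by
  have map_congr : ∀ s ⊆ m.nodes, s.map g.toEmbedding = s.map g'.toEmbedding := fun s hs => by
    rw [Finset.map_eq_image, Finset.map_eq_image]
    exact Finset.image_congr fun a ha => h a (hs ha)
  refine Market.ext
    (map_congr _ (Finset.subset_union_left.trans Finset.subset_union_left))
    (map_congr _ (Finset.subset_union_right.trans Finset.subset_union_left))
    (map_congr _ Finset.subset_union_right) ?_
  simp only [relabel, Finset.map_eq_image]
  exact Finset.image_congr fun e he => Prod.ext (h _ (m.source_mem e he))
    (h _ (Finset.mem_union_left _ (m.target_mem e he)))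

/-- The name of a newcomer depends on the numerical values of the names in use, so only a suitable
modification of `g` carries the newcomer of `m` to that of `m.relabel g`. -/
theorem exists_perm_fresh (g : Equiv.Perm ℕ) (m : Market) :
    ∃ g' : Equiv.Perm ℕ, (∀ a ∈ m.nodes, g' a = g a) ∧ g' m.fresh = (m.relabel g').fresh := by
  set f := (m.relabel g).fresh
  have hagree : ∀ a ∈ m.nodes, (g.trans (Equiv.swap (g m.fresh) f)) a = g a := fun a ha => by
    have hga : g a ∈ (m.relabel g).nodes := by
      rw [nodes_relabel]
      exact Finset.mem_map_of_mem g.toEmbedding ha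
    have hfresh : g a ≠ g m.fresh := g.injective.ne (ne_of_mem_of_not_mem ha m.fresh_notMem)
    have hf : g a ≠ f := ne_of_mem_of_not_mem hga (m.relabel g).fresh_notMem
    rw [Equiv.trans_apply, Equiv.swap_apply_of_ne_of_ne hfresh hf]
  refine ⟨_, hagree, ?_⟩
  rw [relabel_congr hagree, Equiv.trans_apply, Equiv.swap_apply_left]

theorem newPairs_relabel (hg : g m.fresh = (m.relabel g).fresh) :
    (m.relabel g).newPairs = m.newPairs.map (g.prodCongr g).toEmbedding := by
  have hfresh : ∀ x, x = (m.relabel g).fresh ↔ g.symm x = m.fresh := fun x => by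
    rw [← hg, Equiv.symm_apply_eq]
  ext ⟨a, b⟩
  simp only [newPairs, waiting_relabel, nodes_relabel, Finset.mem_map_equiv, Finset.mem_union,
    Finset.mem_product, Finset.mem_singleton, hfresh, Equiv.prodCongr_symm, Equiv.prodCongr_apply,
    Prod.map_apply]

theorem arrive_relabel (hg : g m.fresh = (m.relabel g).fresh) (T : AgentType)
    (N : Finset (ℕ × ℕ)) :
    (m.relabel g).arrive T (N.map (g.prodCongr g).toEmbedding) = (m.arrive T N).relabel g := by
  have map_insert : ∀ s : Finset ℕ, insert (m.relabel g).fresh (s.map g.toEmbedding) =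
      (insert m.fresh s).map g.toEmbedding := fun s => by
    rw [← hg, Finset.map_insert, Equiv.coe_toEmbedding]
  refine Market.ext ?_ ?_ rfl ?_
  · cases T
    exacts [map_insert _, rfl]
  · cases T
    exacts [rfl, map_insert _]
  · simp only [arrive, newPairs_relabel hg, ← Finset.map_inter]
    exact (Finset.map_union _ _).symm

theorem image_snd_map (g : Equiv.Perm ℕ) (M : Finset (ℕ × ℕ)) :
    (M.map (g.prodCongr g).toEmbedding).image Prod.snd = (M.image Prod.snd).map g.toEmbedding := by
  simp only [Finset.map_eq_image, Finset.image_image]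
  rfl

theorem image_fst_map (g : Equiv.Perm ℕ) (M : Finset (ℕ × ℕ)) :
    (M.map (g.prodCongr g).toEmbedding).image Prod.fst = (M.image Prod.fst).map g.toEmbedding := by
  simp only [Finset.map_eq_image, Finset.image_image]
  rfl

theorem execute_relabel (g : Equiv.Perm ℕ) (m : Market) (M : Finset (ℕ × ℕ)) :
    (m.relabel g).execute (M.map (g.prodCongr g).toEmbedding) = (m.execute M).relabel g := by
  refine Market.ext ?_ ?_ ?_ ?_
  · simp only [execute, relabel, image_snd_map, Finset.map_sdiff]
  · simp only [execute, relabel, image_snd_map, Finset.map_sdiff]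
  · simp only [execute, relabel, image_snd_map, image_fst_map, Finset.map_sdiff, Finset.map_union]
  · simp only [execute, relabel, image_snd_map, image_fst_map, ← Finset.map_sdiff,
      ← Finset.map_union]
    ext ⟨a, b⟩
    simp only [Finset.mem_filter, Finset.mem_map_equiv, Equiv.prodCongr_symm, Equiv.prodCongr_apply,
      Prod.map_apply]

theorem mem_hard_arrive {b : ℕ} (h : b ∈ m.hard) (T : AgentType) (N : Finset (ℕ × ℕ)) :
    b ∈ (m.arrive T N).hard := by
  cases T
  exacts [Finset.mem_insert_of_mem h, h]

theorem waiting_arrive (m : Market) (T : AgentType) (N : Finset (ℕ × ℕ)) :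
    (m.arrive T N).waiting = insert m.fresh m.waiting := by
  cases T
  exacts [Finset.insert_union _ _ _, Finset.union_insert _ _ _]

theorem waiting_execute (m : Market) (M : Finset (ℕ × ℕ)) :
    (m.execute M).waiting = m.waiting \ M.image Prod.snd :=
  (Finset.union_sdiff_distrib _ _ _).symm

theorem disjoint_waiting_bridges (m : Market) : Disjoint m.waiting m.bridges :=
  Finset.disjoint_union_left.2 ⟨m.disjoint_hard_bridges, m.disjoint_easy_bridges⟩

end Market

section Step

variable {θ : Params} {P : Policy} {T : AgentType} {m m' : Market} {g : Equiv.Perm ℕ}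

theorem arrivalLaw_relabel (hg : g m.fresh = (m.relabel g).fresh) (T : AgentType) :
    arrivalLaw θ T (m.relabel g) = (arrivalLaw θ T m).map (Market.relabel g) := by
  have hprob : ∀ e : ℕ × ℕ,
      (if (g.prodCongr g e).2 ∈ ((m.relabel g).arrive T ∅).hard then θ.pH else θ.pE) =
        if e.2 ∈ (m.arrive T ∅).hard then θ.pH else θ.pE := fun e => by
    rw [← Finset.map_empty (g.prodCongr g).toEmbedding, Market.arrive_relabel hg]
    exact if_congr (Finset.mem_map' g.toEmbedding) rfl rfl
  rw [arrivalLaw, Market.newPairs_relabel hg, randomSubset_map_embedding _ _ fun e _ => hprob e,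
    arrivalLaw, PMF.map_comp, PMF.map_comp]
  exact congrArg (PMF.map · _) (funext fun N => Market.arrive_relabel hg T N)

theorem stepOfType_relabel (hg : g m.fresh = (m.relabel g).fresh) (T : AgentType) :
    stepOfType θ P T (m.relabel g) = (stepOfType θ P T m).map (Market.relabel g) := by
  rw [stepOfType, arrivalLaw_relabel hg, PMF.bind_map, stepOfType, PMF.map_bind]
  refine congrArg (PMF.bind _) (funext fun m' => ?_)
  rw [Function.comp_apply, P.anonymous, PMF.map_comp, PMF.map_comp]
  exact congrArg (PMF.map · _) (funext fun M => Market.execute_relabel g m' M)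

theorem step_relabel (hg : g m.fresh = (m.relabel g).fresh) :
    step θ P (m.relabel g) = (step θ P m).map (Market.relabel g) := by
  simp only [step, PMF.map_bind, stepOfType_relabel hg]

theorem mem_support_stepOfType : m' ∈ (stepOfType θ P T m).support ↔
    ∃ m₁ ∈ (arrivalLaw θ T m).support, ∃ M ∈ (P.choose m₁).support, m₁.execute M = m' := by
  simp only [stepOfType, PMF.mem_support_bind_iff, PMF.mem_support_map_iff]

theorem exists_execute_of_mem_support_step (h : m' ∈ (step θ P m).support) :
    ∃ T N M, (m.arrive T N).Feasible M ∧ (m.arrive T N).execute M = m' := by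
  obtain ⟨T, -, hT⟩ := (PMF.mem_support_bind_iff _ _ _).1 h
  obtain ⟨m₁, hm₁, M, hM, hm'⟩ := mem_support_stepOfType.1 hT
  obtain ⟨N, -, rfl⟩ := (PMF.mem_support_map_iff _ _ _).1 hm₁
  exact ⟨T, N, M, P.feasible _ M hM, hm'⟩

theorem waiting_subset_of_mem_support_step (h : m' ∈ (step θ P m).support) :
    m'.waiting ⊆ insert m.fresh m.waiting := by
  obtain ⟨T, N, M, -, rfl⟩ := exists_execute_of_mem_support_step h
  rw [Market.waiting_execute, Market.waiting_arrive]
  exact Finset.sdiff_subset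

/-! ### The number of bridge agents is conserved -/

theorem Market.Feasible.card_bridges_execute {M : Finset (ℕ × ℕ)} (h : m.Feasible M) :
    (m.execute M).bridges.card = m.bridges.card := by
  have hgivers : (M.image Prod.fst).card = M.card := Finset.card_image_of_injOn h.gives_once
  have hreceivers : (M.image Prod.snd).card = M.card := Finset.card_image_of_injOn h.receives_once
  have hsub : M.image Prod.fst ⊆ m.bridges ∪ M.image Prod.snd := Finset.image_subset_iff.2
    fun e he => Finset.mem_union.2 ((h.giver e he).imp_right Finset.mem_image.2)
  have hdisj : Disjoint m.bridges (M.image Prod.snd) :=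
    (m.disjoint_waiting_bridges.mono_left <| Finset.image_subset_iff.2 fun e he =>
      m.target_mem e (h.subset_edges he)).symm
  change ((m.bridges ∪ M.image Prod.snd) \ M.image Prod.fst).card = _
  rw [Finset.card_sdiff_of_subset hsub, Finset.card_union_of_disjoint hdisj, hgivers, hreceivers,
    Nat.add_sub_cancel]

theorem card_bridges_of_mem_support_step (h : m' ∈ (step θ P m).support) :
    m'.bridges.card = m.bridges.card := by
  obtain ⟨T, N, M, hM, rfl⟩ := exists_execute_of_mem_support_step h
  exact hM.card_bridges_execute

theorem card_bridges_of_mem_support_stepN {k : ℕ} (h : m' ∈ (stepN θ P m k).support) :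
    m'.bridges.card = m.bridges.card := by
  induction k generalizing m' with
  | zero => rw [(PMF.mem_support_pure_iff _ _).1 h]
  | succ k ih =>
    obtain ⟨m₁, hm₁, hm'⟩ := (PMF.mem_support_bind_iff _ _ _).1 h
    exact (card_bridges_of_mem_support_step hm').trans (ih hm₁)

/-- Convergence in law shows that every state charged by the steady state is reached from the
initial market. -/
theorem IsSteadyState.card_bridges {d : ℕ} {ρ : PMF Market} (h : IsSteadyState θ d P ρ)
    (hm : m ∈ ρ.support) : m.bridges.card = d := by
  have hpos : ρ.map Market.toClass m.toClass ≠ 0 :=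
    (PMF.mem_support_iff _ _).1 ((PMF.mem_support_map_iff _ _ _).2 ⟨m, hm, rfl⟩)
  obtain ⟨t, ht⟩ := ((h.ergodic m.toClass).eventually_ne hpos).exists
  obtain ⟨k, hk⟩ := not_forall.1 (mt ENNReal.tsum_eq_zero.2 ht)
  obtain ⟨m', hm', hclass⟩ := (PMF.mem_support_map_iff _ _ _).1
    ((PMF.mem_support_iff _ _).2 (right_ne_zero_of_mul hk))
  obtain ⟨g, rfl⟩ : ∃ g : Equiv.Perm ℕ, m = m'.relabel g := Quotient.exact hclass
  rw [Market.relabel, Finset.card_map, card_bridges_of_mem_support_stepN hm']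
  exact Finset.card_range d

/-! ### The market as a population chain -/

variable (θ P) in
/-- The waiting agents, as a population with arrivals. -/
noncomputable def marketChain : PopulationChain Market ℕ where
  kernel := step θ P
  pop := Market.waiting
  newcomer := Market.fresh
  relabel := Market.relabel
  newcomer_notMem := Market.fresh_notMem_waiting
  pop_subset := fun _ _ => waiting_subset_of_mem_support_step
  pop_relabel := Market.waiting_relabel
  kernel_relabel := fun g m => by
    obtain ⟨g', hg', hfresh⟩ := m.exists_perm_fresh g
    refine ⟨g', fun a ha => hg' a (Finset.mem_union_left _ ha), ?_⟩
    rw [← Market.relabel_congr hg', step_relabel hfresh]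

theorem IsSteadyState.stationary_marketChain {d : ℕ} {ρ : PMF Market}
    (h : IsSteadyState θ d P ρ) : (marketChain θ P).Stationary ρ := fun f hf => by
  let f' : Market.IsoClass → ℝ≥0∞ := Quotient.lift f fun m m' hmm' => by
    obtain ⟨g, rfl⟩ := hmm'
    exact (hf g m).symm
  have hclass : ∀ μ : PMF Market, expect μ f = expect (μ.map Market.toClass) f' := fun μ =>
    (expect_map μ Market.toClass f').symm
  rw [hclass, hclass, ← h.stationary, marketChain]

theorem stillWaiting_eq_stillPresent (a k : ℕ) (m : Market) :
    stillWaiting θ P a k m = (marketChain θ P).stillPresent k m a := by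
  induction k generalizing m with
  | zero => rfl
  | succ k ih =>
    rw [PopulationChain.stillPresent, Function.iterate_succ_apply', stillWaiting]
    simp only [ih]
    rfl

theorem newcomerMean_stillPresent (ρ : PMF Market) (k : ℕ) :
    (marketChain θ P).newcomerMean ρ ((marketChain θ P).stillPresent k) =
      expect (arrivalType θ) fun T => newcomerStillWaiting θ P ρ T k := by
  simp only [newcomerStillWaiting, stillWaiting_eq_stillPresent]
  change expect ρ (fun m => expect (step θ P m) _) = _
  simp only [step, expect_bind]
  exact expect_comm _ _ _

theorem mem_support_arrivalType_iff (h : 0 < θ.totalRate) :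
    T ∈ (arrivalType θ).support ↔ θ.rate T ≠ 0 := by
  have hE : 1 - θ.lamH / θ.totalRate = 0 ↔ θ.lamE = 0 := by
    rw [tsub_eq_zero_iff_le, one_le_div₀ h, Params.totalRate, add_le_iff_nonpos_right,
      nonpos_iff_eq_zero]
  rw [arrivalType, PMF.mem_support_map_iff]
  simp only [PMF.mem_support_ofFintype_iff, Bool.exists_bool, cond_true, cond_false, ne_eq,
    ENNReal.coe_eq_zero, hE, div_eq_zero_iff, h.ne', or_false]
  cases T <;> simp [Params.rate]

theorem meanSojourn_marketChain_le (h : 0 < θ.totalRate) (ρ : PMF Market) :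
    (marketChain θ P).meanSojourn ρ ≤
      θ.totalRate * (waitingTime θ P ρ .H + waitingTime θ P ρ .E) := by
  simp only [PopulationChain.meanSojourn, newcomerMean_stillPresent, ← expect_tsum]
  refine expect_le_of_le fun T hT => ?_
  rw [tsum_newcomerStillWaiting P ρ ((mem_support_arrivalType_iff h).1 hT)]
  cases T
  exacts [mul_le_mul_right le_self_add _, mul_le_mul_right le_add_self _]

end Step

/-! ### Waiting for the first usable edge -/

/-- The probability that a hard-to-match agent finds an item incompatible. -/
noncomputable def Params.missH (θ : Params) : ℝ≥0∞ := ENNReal.ofReal (1 - (θ.pH : ℝ))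

theorem Params.missH_add (θ : Params) : θ.missH + ENNReal.ofReal θ.pH = 1 := by
  rw [Params.missH, ← ENNReal.ofReal_add (sub_nonneg.2 θ.pH.2.2) θ.pH.2.1, sub_add_cancel,
    ENNReal.ofReal_one]

theorem Params.missH_le_one (θ : Params) : θ.missH ≤ 1 := le_self_add.trans_eq θ.missH_add

theorem Params.one_sub_missH (θ : Params) : 1 - θ.missH = ENNReal.ofReal θ.pH :=
  ENNReal.sub_eq_of_eq_add_rev ENNReal.ofReal_ne_top θ.missH_add.symm

theorem one_le_pow_add_mul {p q : ℝ≥0∞} (h : q + p = 1) (n : ℕ) : 1 ≤ q ^ n + p * n := by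
  induction n with
  | zero => simp
  | succ n ih =>
    calc 1 = q * 1 + p := by rw [mul_one, h]
      _ ≤ q * (q ^ n + p * n) + p := by gcongr
      _ ≤ q * q ^ n + 1 * (p * n) + p := by
        rw [mul_add]
        gcongr
        exact le_self_add.trans_eq h
      _ = q ^ (n + 1) + p * (n + 1 : ℕ) := by push_cast; ring

section Blocked

variable {θ : Params} {P : Policy} {T : AgentType} {m : Market} {b : ℕ}

variable (θ P) in
/-- The hard-to-match agent `b` has no incoming edge that might ever be used: all her in-neighbours
keep waiting forever, and hence keep their items. -/
def Blocked (m : Market) (b : ℕ) : Prop :=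
  b ∈ m.hard ∧ ∀ x, (x, b) ∈ m.edges → (marketChain θ P).Permanent m x

variable (θ P) in
open Classical in
/-- The potential edges created by the next arrival which, if realized, might be used to serve
`b`. -/
noncomputable def riskyPairs (m : Market) (b : ℕ) : Finset (ℕ × ℕ) :=
  m.newPairs.filter fun e => e.2 = b ∧ ¬ (marketChain θ P).Permanent m e.1

theorem mem_riskyPairs {e : ℕ × ℕ} : e ∈ riskyPairs θ P m b ↔
    e ∈ m.newPairs ∧ e.2 = b ∧ ¬ (marketChain θ P).Permanent m e.1 := by
  classical exact Finset.mem_filter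

theorem Blocked.mem_waiting (h : Blocked θ P m b) : b ∈ m.waiting :=
  Finset.mem_union_left _ h.1

/-- A donor of `b` would have to be a bridge agent or to receive an item herself, but the
in-neighbours of `b` are still waiting afterwards. -/
theorem Market.Feasible.blocked_execute {M : Finset (ℕ × ℕ)} (hM : m.Feasible M) (hb : b ∈ m.hard)
    (hin : ∀ x, (x, b) ∈ m.edges → (marketChain θ P).Permanent (m.execute M) x) :
    Blocked θ P (m.execute M) b := by
  refine ⟨Finset.mem_sdiff.2 ⟨hb, fun hserved => ?_⟩, fun x hx => hin x (Finset.mem_filter.1 hx).1⟩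
  obtain ⟨⟨x, b⟩, hxb, rfl⟩ := Finset.mem_image.1 hserved
  have hx : x ∈ m.waiting \ M.image Prod.snd :=
    m.waiting_execute M ▸ (hin x (hM.subset_edges hxb)).mem_pop
  rw [Finset.mem_sdiff] at hx
  rcases hM.giver _ hxb with hbridge | hserved
  · exact Finset.disjoint_left.1 m.disjoint_waiting_bridges hx.1 hbridge
  · exact hx.2 (Finset.mem_image.2 hserved)

theorem toOuterMeasure_arrivalLaw_permanent (hb : b ∈ (m.arrive T ∅).hard)
    (hin : ∀ x, (x, b) ∈ m.edges → (marketChain θ P).Permanent m x) :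
    (arrivalLaw θ T m).toOuterMeasure
        {m' | ∀ x, (x, b) ∈ m'.edges → (marketChain θ P).Permanent m x} =
      θ.missH ^ (riskyPairs θ P m b).card := by
  have hset : m.arrive T ⁻¹' {m' | ∀ x, (x, b) ∈ m'.edges → (marketChain θ P).Permanent m x} =
      {N | Disjoint N (riskyPairs θ P m b)} := by
    ext N
    simp only [Set.mem_preimage, Set.mem_ofPred_eq, Market.arrive, Finset.mem_union,
      Finset.mem_inter, Finset.disjoint_left, mem_riskyPairs]
    grind
  have hprob : ∀ e ∈ riskyPairs θ P m b,
      (1 - ((if e.2 ∈ (m.arrive T ∅).hard then θ.pH else θ.pE : I) : ℝ)) = 1 - θ.pH :=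
    fun e he => by rw [(mem_riskyPairs.1 he).2.1, if_pos hb]
  rw [arrivalLaw, PMF.toOuterMeasure_map_apply, hset,
    toOuterMeasure_randomSubset_disjoint _ fun e he => (mem_riskyPairs.1 he).1,
    Finset.prod_congr rfl hprob, Finset.prod_const,
    ENNReal.ofReal_pow (sub_nonneg.2 θ.pH.2.2), Params.missH]

theorem mul_pow_card_riskyPairs_le_expect {f : Market → ℝ≥0∞} {c : ℝ≥0∞}
    (hT : T ∈ (arrivalType θ).support) (hb : b ∈ (m.arrive T ∅).hard)
    (hin : ∀ x, (x, b) ∈ m.edges → (marketChain θ P).Permanent m x)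
    (hf : ∀ m', Blocked θ P m' b → c ≤ f m') :
    c * θ.missH ^ (riskyPairs θ P m b).card ≤ expect (stepOfType θ P T m) f := by
  rw [← toOuterMeasure_arrivalLaw_permanent hb hin, stepOfType, expect_bind]
  refine mul_toOuterMeasure_le_expect _ fun m₁ hm₁ hperm => ?_
  rw [expect_map]
  refine le_expect_of_le fun M hM => hf _ <| (P.feasible m₁ M hM).blocked_execute ?_ fun x hx =>
    (hperm x hx).of_mem_support <| (PMF.mem_support_bind_iff _ _ _).2
      ⟨T, hT, mem_support_stepOfType.2 ⟨m₁, hm₁, M, hM, rfl⟩⟩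
  obtain ⟨N, -, rfl⟩ := (PMF.mem_support_map_iff _ _ _).1 hm₁
  exact hb

theorem card_riskyPairs_le_one (hb : b ∈ m.waiting) : (riskyPairs θ P m b).card ≤ 1 := by
  have hne : b ≠ m.fresh := ne_of_mem_of_not_mem hb m.fresh_notMem_waiting
  refine Finset.card_le_one_iff_subset_singleton.2 ⟨(m.fresh, b), fun e he => ?_⟩
  simp only [mem_riskyPairs, Market.newPairs, Finset.mem_union, Finset.mem_product,
    Finset.mem_singleton] at he ⊢
  grind

theorem card_riskyPairs_fresh_le (m : Market) :
    (riskyPairs θ P m m.fresh).card ≤ m.bridges.card + ((marketChain θ P).leavers m).card := by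
  have hsub : riskyPairs θ P m m.fresh ⊆
      (m.bridges ∪ (marketChain θ P).leavers m) ×ˢ {m.fresh} := fun e he => by
    have hfresh := m.fresh_notMem_waiting
    have hpop : (marketChain θ P).pop m = m.waiting := rfl
    simp only [mem_riskyPairs, Market.newPairs, Market.nodes, PopulationChain.leavers, hpop,
      Finset.mem_filter, Finset.mem_union, Finset.mem_product, Finset.mem_singleton] at he ⊢
    grind
  calc (riskyPairs θ P m m.fresh).card
      ≤ ((m.bridges ∪ (marketChain θ P).leavers m) ×ˢ {m.fresh}).card := Finset.card_le_card hsub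
    _ = (m.bridges ∪ (marketChain θ P).leavers m).card := by
        rw [Finset.card_product, Finset.card_singleton, mul_one]
    _ ≤ m.bridges.card + ((marketChain θ P).leavers m).card := Finset.card_union_le _ _

theorem Blocked.pow_missH_le_stillWaiting (h : Blocked θ P m b) (k : ℕ) :
    θ.missH ^ k ≤ stillWaiting θ P b k m := by
  induction k generalizing m with
  | zero => rw [pow_zero, stillWaiting, if_pos h.mem_waiting]
  | succ k ih =>
    rw [stillWaiting, if_pos h.mem_waiting]
    change _ ≤ expect (step θ P m) (stillWaiting θ P b k)
    rw [step, expect_bind]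
    refine le_expect_of_le fun T hT => ?_
    calc θ.missH ^ (k + 1) = θ.missH ^ k * θ.missH ^ 1 := pow_add _ _ _
      _ ≤ θ.missH ^ k * θ.missH ^ (riskyPairs θ P m b).card := mul_le_mul_right
          (pow_le_pow_right_of_le_one' θ.missH_le_one (card_riskyPairs_le_one h.mem_waiting)) _
      _ ≤ expect (stepOfType θ P T m) (stillWaiting θ P b k) := mul_pow_card_riskyPairs_le_expect
          hT (Market.mem_hard_arrive h.1 T ∅) h.2 fun _ hm' => ih hm'

theorem pow_missH_mul_le_expect_stepOfType (hH : AgentType.H ∈ (arrivalType θ).support) (k : ℕ)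
    (m : Market) :
    θ.missH ^ k * (θ.missH ^ m.bridges.card * θ.missH ^ ((marketChain θ P).leavers m).card) ≤
      expect (stepOfType θ P .H m) (stillWaiting θ P m.fresh k) := by
  rw [← pow_add]
  refine (mul_le_mul_right
    (pow_le_pow_right_of_le_one' θ.missH_le_one (card_riskyPairs_fresh_le m)) _).trans ?_
  exact mul_pow_card_riskyPairs_le_expect hH (Finset.mem_insert_self _ _)
    (fun x hx => absurd (m.target_mem _ hx) m.fresh_notMem_waiting)
    fun _ hm' => hm'.pow_missH_le_stillWaiting k

end Blocked

/-! ### Waiting times in steady state -/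

namespace IsSteadyState

variable {θ : Params} {d : ℕ} {P : Policy} {ρ : PMF Market}

theorem pow_missH_mul_expect_le_waitingTime (h : IsSteadyState θ d P ρ) (hH : 0 < θ.lamH)
    (hp : 0 < (θ.pH : ℝ)) :
    θ.missH ^ d * expect ρ (fun m => θ.missH ^ ((marketChain θ P).leavers m).card) ≤
      ENNReal.ofReal θ.pH * (θ.totalRate * waitingTime θ P ρ .H) := by
  have hrate : θ.rate .H ≠ 0 := hH.ne'
  have hsupp := (mem_support_arrivalType_iff (θ.totalRate_pos hrate)).2 hrate
  have hgeom : ENNReal.ofReal θ.pH * ∑' k : ℕ, θ.missH ^ k = 1 := by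
    rw [ENNReal.tsum_geometric, θ.one_sub_missH,
      ENNReal.mul_inv_cancel (ENNReal.ofReal_pos.2 hp).ne' ENNReal.ofReal_ne_top]
  have hnewcomer : ∀ k, θ.missH ^ k *
      (θ.missH ^ d * expect ρ fun m => θ.missH ^ ((marketChain θ P).leavers m).card) ≤
        newcomerStillWaiting θ P ρ .H k := fun k => by
    rw [← expect_mul_left, ← expect_mul_left]
    exact expect_mono fun m hm =>
      h.card_bridges hm ▸ pow_missH_mul_le_expect_stepOfType hsupp k m
  rw [← tsum_newcomerStillWaiting P ρ hrate]
  refine le_trans ?_ (mul_le_mul_right (ENNReal.tsum_le_tsum hnewcomer) _)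
  rw [ENNReal.tsum_mul_right, ← mul_assoc, hgeom, one_mul]

theorem one_le_expect_pow_missH_add (h : IsSteadyState θ d P ρ) (hrate : 0 < θ.totalRate) :
    1 ≤ expect ρ (fun m => θ.missH ^ ((marketChain θ P).leavers m).card) +
      ENNReal.ofReal θ.pH *
        (θ.totalRate * (waitingTime θ P ρ .H + waitingTime θ P ρ .E)) := by
  have hleavers : expect ρ (fun m => ((marketChain θ P).leavers m).card) ≤
      θ.totalRate * (waitingTime θ P ρ .H + waitingTime θ P ρ .E) :=
    (PopulationChain.expect_card_leavers_le h.stationary_marketChain).trans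
      (meanSojourn_marketChain_le hrate ρ)
  refine le_trans ?_ (add_le_add_right (mul_le_mul_right hleavers _) _)
  rw [← expect_mul_left, ← expect_add]
  exact le_expect_of_le fun m _ => one_le_pow_add_mul θ.missH_add _

theorem le_waitingTime_add (h : IsSteadyState θ d P ρ) (hH : 0 < θ.lamH) (hp : 0 < (θ.pH : ℝ))
    {δ : ℝ} (hδ : 0 ≤ δ) (hδd : δ ≤ (1 - (θ.pH : ℝ)) ^ d) :
    ENNReal.ofReal (δ / ((1 + δ) * θ.totalRate) / θ.pH) ≤
      waitingTime θ P ρ .H + waitingTime θ P ρ .E := by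
  have hrate : 0 < θ.totalRate := hH.trans_le le_self_add
  set S := waitingTime θ P ρ .H + waitingTime θ P ρ .E
  set Q := expect ρ fun m => θ.missH ^ ((marketChain θ P).leavers m).card
  set p := ENNReal.ofReal θ.pH
  set ε := ENNReal.ofReal δ
  have hε : ε ≤ θ.missH ^ d := by
    rw [Params.missH, ← ENNReal.ofReal_pow (sub_nonneg.2 θ.pH.2.2)]
    exact ENNReal.ofReal_le_ofReal hδd
  have hQ : θ.missH ^ d * Q ≤ p * (θ.totalRate * S) :=
    (h.pow_missH_mul_expect_le_waitingTime hH hp).trans <|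
      mul_le_mul_right (mul_le_mul_right le_self_add _) _
  have key : ε ≤ S * ((1 + ε) * θ.totalRate * p) :=
    calc ε ≤ ε * (Q + p * (θ.totalRate * S)) :=
          le_mul_of_one_le_right zero_le (h.one_le_expect_pow_missH_add hrate)
      _ ≤ θ.missH ^ d * Q + ε * (p * (θ.totalRate * S)) := by rw [mul_add]; gcongr
      _ ≤ p * (θ.totalRate * S) + ε * (p * (θ.totalRate * S)) := add_le_add_left hQ _
      _ = S * ((1 + ε) * θ.totalRate * p) := by ring
  have hden : 0 < (1 + δ) * θ.totalRate * θ.pH := by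
    have := NNReal.coe_pos.2 hrate
    positivity
  rw [div_div, ENNReal.ofReal_div_of_pos hden, ENNReal.ofReal_mul (by positivity),
    ENNReal.ofReal_mul (by positivity), ENNReal.ofReal_add zero_le_one hδ, ENNReal.ofReal_one,
    ENNReal.ofReal_coe_nnreal]
  exact ENNReal.div_le_of_le_mul key

end IsSteadyState

end DynamicMatching

theorem mainTheorem11 (d : ℕ) (pE : I) (lamH lamE : ℝ≥0) (hlamH : 0 < lamH)
    (pmax : ℝ) (hpmax : d = 0 ∨ pmax < 1) :
    ∃ c : ℝ, 0 < c ∧ ∀ pH : I, 0 < (pH : ℝ) → (pH : ℝ) ≤ pmax →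
      ∀ (P : DynamicMatching.Policy) (ρ : PMF DynamicMatching.Market),
        DynamicMatching.IsSteadyState ⟨lamH, lamE, pH, pE⟩ d P ρ →
          ENNReal.ofReal (c / pH) ≤
            DynamicMatching.waitingTime ⟨lamH, lamE, pH, pE⟩ P ρ .H +
              DynamicMatching.waitingTime ⟨lamH, lamE, pH, pE⟩ P ρ .E := by
  obtain ⟨δ, hδ, hδle⟩ : ∃ δ : ℝ, 0 < δ ∧ ∀ pH : I, (pH : ℝ) ≤ pmax → δ ≤ (1 - (pH : ℝ)) ^ d := by
    rcases hpmax with rfl | hpmax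
    · exact ⟨1, one_pos, fun pH _ => (pow_zero _).ge⟩
    · exact ⟨(1 - pmax) ^ d, pow_pos (sub_pos.2 hpmax) d, fun pH hpH =>
        pow_le_pow_left₀ (sub_pos.2 hpmax).le (sub_le_sub_left hpH 1) d⟩
  have hrate : (0 : ℝ) < (lamH + lamE : ℝ≥0) := NNReal.coe_pos.2 (hlamH.trans_le le_self_add)
  exact ⟨δ / ((1 + δ) * (lamH + lamE : ℝ≥0)), div_pos hδ (mul_pos (by positivity) hrate),
    fun pH hpos hle P ρ hρ => hρ.le_waitingTime_add hlamH hpos hδ.le (hδle pH hle)⟩
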